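/- Let $V_0,V_1$ be the operators on $L^2(\mathbb T^2)$ given by multiplication by the two coordinate functions, $(V_kf)(\zeta_0,\zeta_1)=\zeta_k f(\zeta_0,\zeta_1)$, $k=0,1$, and put $e_{ij}(\zeta_0,\zeta_1)=\zeta_0^i\zeta_1^j$ for $i,j\in\mathbb Z$. For $\Gamma\subset\mathbb Z^2$ let $H_\Gamma$ be the closed linear span of $\{e_{ij}:(i,j)\in\Gamma\}$. Let $\Gamma$ and $\Gamma'$ be nonempty proper subsets of $\mathbb Z^2$ such that $H_\Gamma$ and $H_{\Gamma'}$ are invariant under $V_0$ and $V_1$ (equivalently, $\Gamma+\mathbb N^2\subset\Gamma$ and $\Gamma'+\mathbb N^2\subset\Gamma'$, where $0\in\mathbb N$). (1) The pairs $(V_0|H_\Gamma,V_1|H_\Gamma)$ and $(V_0|H_{\Gamma'},V_1|H_{\Gamma'})$ are unitarily equivalent, that is, there is a unitary operator $U:H_\Gamma\to H_{\Gamma'}$ with $U(V_k|H_\Gamma)=(V_k|H_{\Gamma'})U$ for $k=0,1$, if and only if $\Gamma'=\Gamma+\gamma$ for some $\gamma\in\mathbb Z^2$. (2) The pair $(V_0|H_\Gamma,V_1|H_\Gamma)$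 is reducible, that is, there is a closed subspace $M$ of $H_\Gamma$, different from $\{0\}$ and $H_\Gamma$, such that $M$ and $H_\Gamma\ominus M$ are both invariant under $V_0$ and $V_1$, if and only if $\Gamma=\Gamma+\gamma$ for some $\gamma\in\mathbb Z^2\setminus\{(0,0)\}$. -/

import Mathlib

open MeasureTheory

noncomputable section

/-- A family of commuting isometric operators on a complex inner product space, indexed by `ι`. -/
structure CommutingIsometries (ι H : Type*) [NormedAddCommGroup H] [InnerProductSpace ℂ H] where
  op : ι → H →ₗᵢ[ℂ] H
  commute : ∀ i j x, op i (op j x) = op j (op i x)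

namespace CommutingIsometries

variable {ι H K : Type*} [NormedAddCommGroup H] [InnerProductSpace ℂ H]
  [NormedAddCommGroup K] [InnerProductSpace ℂ K]

/-- `M` is invariant for the family `V`: each operator of the family maps `M` into `M`. -/
def IsInvariant (V : CommutingIsometries ι H) (M : Submodule ℂ H) : Prop :=
  ∀ i, ∀ x ∈ M, V.op i x ∈ M

/-- `M` is a reducing (closed) subspace for `V`: `M` and its orthogonal complement are invariant. -/
def IsReducing (V : CommutingIsometries ι H) (M : Submodule ℂ H) : Prop :=
  IsClosed (M : Set H) ∧ V.IsInvariant M ∧ V.IsInvariant Mᗮ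

/-- `V` has no reducing subspaces other than `{0}` and the whole space. -/
def IsIrreducible (V : CommutingIsometries ι H) : Prop :=
  ∀ M : Submodule ℂ H, V.IsReducing M → M = ⊥ ∨ M = ⊤

/-- `V` has a reducing subspace different from `{0}` and from the whole space. -/
def IsReducible (V : CommutingIsometries ι H) : Prop :=
  ¬ V.IsIrreducible

/-- The restriction of the family `V` to an invariant subspace `M`. -/
def restrict (V : CommutingIsometries ι H) (M : Submodule ℂ H) (hM : V.IsInvariant M) :
    CommutingIsometries ι M where
  op i :=
    { toLinearMap := (V.op i).toLinearMap.restrict (hM i)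
      norm_map' := fun x => (V.op i).norm_map x }
  commute i j x := Subtype.ext (V.commute i j x)

/-- Two families are unitarily equivalent if a unitary operator (a surjective linear isometry)
intertwines them. -/
def UnitarilyEquivalent (V : CommutingIsometries ι H) (W : CommutingIsometries ι K) : Prop :=
  ∃ U : H ≃ₗᵢ[ℂ] K, ∀ i x, U (V.op i x) = W.op i (U x)

end CommutingIsometries

/-- The torus `𝕋²`. As in Mathlib, the circle is written `ℝ / ℤ`; the point `x` of `ℝ / ℤ` stands
for the complex number `exp (2 π i x)` of modulus one (see `torusCoord`). -/
abbrev Torus2 : Type := UnitAddTorus (Fin 2)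

/-- Normalized Lebesgue (Haar) measure on the torus. -/
abbrev torusMeasure : Measure Torus2 := Measure.pi fun _ => AddCircle.haarAddCircle

/-- The Hilbert space `L²(𝕋²)`. -/
abbrev L2Torus : Type := Lp ℂ 2 torusMeasure

/-- The coordinate function `ζ_k` on the torus, with values in the unit circle of `ℂ`. -/
def torusCoord (k : Fin 2) (x : Torus2) : Circle := AddCircle.toCircle (x k)

theorem continuous_torusCoord (k : Fin 2) : Continuous (torusCoord k) :=
  AddCircle.continuous_toCircle.comp (continuous_apply k)

theorem continuous_torusCoord_coe (k : Fin 2) : Continuous fun x => (torusCoord k x : ℂ) :=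
  continuous_subtype_val.comp (continuous_torusCoord k)

theorem memLp_torusCoord_mul (k : Fin 2) (f : L2Torus) :
    MemLp (fun x => (torusCoord k x : ℂ) * f x) 2 torusMeasure := by
  refine (Lp.memLp f).of_le
    ((continuous_torusCoord_coe k).aestronglyMeasurable.mul
      (Lp.aestronglyMeasurable f)) (Filter.Eventually.of_forall fun x => ?_)
  simp [Circle.norm_coe]

/-- Multiplication by the coordinate function `ζ_k` on `L²(𝕋²)`. -/
def coordMul (k : Fin 2) : L2Torus →ₗᵢ[ℂ] L2Torus where
  toFun f := (memLp_torusCoord_mul k f).toLp _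
  map_add' f g := by
    apply Lp.ext
    filter_upwards [(memLp_torusCoord_mul k (f + g)).coeFn_toLp,
      (memLp_torusCoord_mul k f).coeFn_toLp, (memLp_torusCoord_mul k g).coeFn_toLp,
      Lp.coeFn_add f g, Lp.coeFn_add ((memLp_torusCoord_mul k f).toLp _)
        ((memLp_torusCoord_mul k g).toLp _)] with x h1 h2 h3 h4 h5
    rw [h1, h5, Pi.add_apply, h2, h3, h4, Pi.add_apply, mul_add]
  map_smul' c f := by
    apply Lp.ext
    filter_upwards [(memLp_torusCoord_mul k (c • f)).coeFn_toLp,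
      (memLp_torusCoord_mul k f).coeFn_toLp, Lp.coeFn_smul c f,
      Lp.coeFn_smul c ((memLp_torusCoord_mul k f).toLp _)] with x h1 h2 h3 h4
    rw [h1, RingHom.id_apply, h4, Pi.smul_apply, h2, h3, Pi.smul_apply, smul_eq_mul, smul_eq_mul,
      mul_left_comm]
  norm_map' f := by
    change ‖(memLp_torusCoord_mul k f).toLp _‖ = ‖f‖
    rw [Lp.norm_toLp, Lp.norm_def]
    congr 1
    exact eLpNorm_congr_norm_ae (Filter.Eventually.of_forall fun x => by simp [Circle.norm_coe])

theorem coordMul_coeFn (k : Fin 2) (f : L2Torus) :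
    coordMul k f =ᵐ[torusMeasure] fun x => (torusCoord k x : ℂ) * f x :=
  (memLp_torusCoord_mul k f).coeFn_toLp

/-- The bi-isometry `(V₀, V₁)` on `L²(𝕋²)` given by multiplication by the two coordinates. -/
def coordBiIsometry : CommutingIsometries (Fin 2) L2Torus where
  op := coordMul
  commute i j f := by
    apply Lp.ext
    filter_upwards [coordMul_coeFn i (coordMul j f), coordMul_coeFn j f,
      coordMul_coeFn j (coordMul i f), coordMul_coeFn i f] with x h1 h2 h3 h4
    rw [h1, h2, h3, h4, mul_left_comm]

/-- The monomial `ζ₀ ^ i * ζ₁ ^ j`, as a continuous function on the torus. -/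
def torusMonomial (g : ℤ × ℤ) : C(Torus2, ℂ) where
  toFun x := (torusCoord 0 x : ℂ) ^ g.1 * (torusCoord 1 x : ℂ) ^ g.2
  continuous_toFun :=
    ((continuous_torusCoord_coe 0).zpow₀ g.1
        fun x => Or.inl (torusCoord 0 x).coe_ne_zero).mul
      ((continuous_torusCoord_coe 1).zpow₀ g.2
        fun x => Or.inl (torusCoord 1 x).coe_ne_zero)

/-- The basis vector `e_{ij}` of `L²(𝕋²)`, for `g = (i, j)`. -/
def torusBasisVec (g : ℤ × ℤ) : L2Torus :=
  ContinuousMap.toLp 2 torusMeasure ℂ (torusMonomial g)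

/-- The space `H_Γ`: the closed linear span of the `e_{ij}` with `(i, j) ∈ Γ`. -/
def spanSpace (Γ : Set (ℤ × ℤ)) : Submodule ℂ L2Torus :=
  (Submodule.span ℂ (torusBasisVec '' Γ)).topologicalClosure

end

open scoped InnerProductSpace

/-! ### The Fourier basis of `L²(𝕋²)` -/

/-! In the monomial basis `V_k` shifts exponents, so an operator intertwining the restrictions to
`H_Γ` and `H_Γ'` is a Toeplitz matrix: its coefficient at `(g + γ, g)` depends only on `γ`
(`Intertwines.inner_eq`). One nonzero coefficient therefore forces `Γ + γ ⊆ Γ'`, and if the adjoint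
intertwines too, `Γ' = Γ + γ` (`Intertwines.eq_image`). Applied to a unitary equivalence this gives
(1); applied to the projection onto a reducing subspace, it shows that without a nonzero period the
projection is scalar, hence trivial. Conversely, multiplication by the monomial of exponent `γ`
carries `H_Γ` onto `H_{Γ+γ}`. If `γ ≠ 0` is a period, this operator plus its adjoint is
self-adjoint, commutes with the pair and is indefinite, so the kernel of its positive part is a
nontrivial reducing subspace (`CommutingIsometries.isReducible_of_inner_eq_zero`). -/

theorem torusMonomial_eq_mFourier (g : ℤ × ℤ) :
    torusMonomial g = UnitAddTorus.mFourier ![g.1, g.2] := by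
  ext x
  simp [torusMonomial, UnitAddTorus.mFourier, torusCoord, fourier_apply, AddCircle.toCircle_zsmul]

theorem torusBasisVec_eq_mFourierLp (g : ℤ × ℤ) :
    torusBasisVec g = UnitAddTorus.mFourierLp 2 ((finTwoArrowEquiv ℤ).symm g) := by
  rw [torusBasisVec, torusMonomial_eq_mFourier]
  rfl

theorem torusBasisVec_eq_comp :
    torusBasisVec = (UnitAddTorus.mFourierLp (d := Fin 2) 2) ∘ (finTwoArrowEquiv ℤ).symm :=
  funext torusBasisVec_eq_mFourierLp

theorem orthonormal_torusBasisVec : Orthonormal ℂ torusBasisVec := by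
  rw [torusBasisVec_eq_comp]
  exact (UnitAddTorus.orthonormal_mFourier (d := Fin 2)).comp _ (Equiv.injective _)

theorem span_torusBasisVec_closure_eq_top :
    (Submodule.span ℂ (Set.range torusBasisVec)).topologicalClosure = ⊤ := by
  rw [torusBasisVec_eq_comp, EquivLike.range_comp]
  exact UnitAddTorus.span_mFourierLp_closure_eq_top (by simp)

theorem ext_inner_torusBasisVec {f₁ f₂ : L2Torus}
    (h : ∀ g, ⟪torusBasisVec g, f₁⟫_ℂ = ⟪torusBasisVec g, f₂⟫_ℂ) : f₁ = f₂ := by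
  have hd : Dense (Submodule.span ℂ (Set.range torusBasisVec) : Set L2Torus) :=
    Submodule.dense_iff_topologicalClosure_eq_top.2 span_torusBasisVec_closure_eq_top
  refine hd.eq_of_inner_right (𝕜 := ℂ) fun v hv => ?_
  induction hv using Submodule.span_induction with
  | mem x hx => obtain ⟨g, rfl⟩ := hx; exact h g
  | zero => simp
  | add x y _ _ hx hy => simp only [inner_add_left, hx, hy]
  | smul c x _ hx => simp only [inner_smul_left, hx]

/-- The exponent by which multiplication by `ζ_k` shifts the monomials. -/
def coordStep : Fin 2 → ℤ × ℤ := ![(1, 0), (0, 1)]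

theorem torusMonomial_add (g h : ℤ × ℤ) (x : Torus2) :
    torusMonomial (g + h) x = torusMonomial g x * torusMonomial h x := by
  simp only [torusMonomial, ContinuousMap.coe_mk, Prod.fst_add, Prod.snd_add,
    zpow_add₀ (Circle.coe_ne_zero _)]
  ring

theorem torusMonomial_coordStep (k : Fin 2) (x : Torus2) :
    torusMonomial (coordStep k) x = torusCoord k x := by
  fin_cases k <;> simp [torusMonomial, coordStep]

theorem coordMul_torusBasisVec (k : Fin 2) (g : ℤ × ℤ) :
    coordMul k (torusBasisVec g) = torusBasisVec (g + coordStep k) := by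
  apply Lp.ext
  filter_upwards [coordMul_coeFn k (torusBasisVec g),
    ContinuousMap.coeFn_toLp (p := 2) (𝕜 := ℂ) torusMeasure (torusMonomial g),
    ContinuousMap.coeFn_toLp (p := 2) (𝕜 := ℂ) torusMeasure (torusMonomial (g + coordStep k))]
    with x h1 h2 h3
  rw [h1, torusBasisVec, torusBasisVec, h2, h3, torusMonomial_add, torusMonomial_coordStep,
    mul_comm]

theorem inner_torusBasisVec_coordMul (k : Fin 2) (g : ℤ × ℤ) (f : L2Torus) :
    ⟪torusBasisVec (g + coordStep k), coordMul k f⟫_ℂ = ⟪torusBasisVec g, f⟫_ℂ := by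
  rw [← coordMul_torusBasisVec, LinearIsometry.inner_map_map]

/-! ### The spaces `H_Γ` -/

theorem torusBasisVec_mem_spanSpace {Γ : Set (ℤ × ℤ)} {g : ℤ × ℤ} (hg : g ∈ Γ) :
    torusBasisVec g ∈ spanSpace Γ :=
  Submodule.le_topologicalClosure _ (Submodule.subset_span (Set.mem_image_of_mem _ hg))

theorem spanSpace_le {Γ : Set (ℤ × ℤ)} {M : Submodule ℂ L2Torus} (hM : IsClosed (M : Set L2Torus))
    (h : ∀ g ∈ Γ, torusBasisVec g ∈ M) : spanSpace Γ ≤ M :=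
  Submodule.topologicalClosure_minimal _ (Submodule.span_le.2 (Set.image_subset_iff.2 h)) hM

theorem isClosed_spanSpace (Γ : Set (ℤ × ℤ)) : IsClosed (spanSpace Γ : Set L2Torus) :=
  Submodule.isClosed_topologicalClosure _

instance completeSpace_spanSpace (Γ : Set (ℤ × ℤ)) : CompleteSpace (spanSpace Γ) :=
  (isClosed_spanSpace Γ).completeSpace_coe

theorem inner_eq_zero_of_mem_spanSpace {Γ : Set (ℤ × ℤ)} {g : ℤ × ℤ} (hg : g ∉ Γ) {f : L2Torus}
    (hf : f ∈ spanSpace Γ) : ⟪torusBasisVec g, f⟫_ℂ = 0 := by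
  have hle : spanSpace Γ ≤ (ℂ ∙ torusBasisVec g)ᗮ := by
    refine spanSpace_le (Submodule.isClosed_orthogonal _) fun h hh => ?_
    rw [Submodule.mem_orthogonal_singleton_iff_inner_right]
    exact orthonormal_torusBasisVec.2 (by rintro rfl; exact hg hh)
  exact Submodule.mem_orthogonal_singleton_iff_inner_right.1 (hle hf)

theorem torusBasisVec_mem_spanSpace_iff {Γ : Set (ℤ × ℤ)} {g : ℤ × ℤ} :
    torusBasisVec g ∈ spanSpace Γ ↔ g ∈ Γ := by
  refine ⟨fun h => ?_, torusBasisVec_mem_spanSpace⟩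
  by_contra hg
  exact orthonormal_torusBasisVec.ne_zero g
    (inner_self_eq_zero.1 (inner_eq_zero_of_mem_spanSpace hg h))

/-- The monomial of exponent `g`, as a vector of `H_Γ`. -/
noncomputable def spanVec {Γ : Set (ℤ × ℤ)} (g : Γ) : spanSpace Γ :=
  ⟨torusBasisVec g, torusBasisVec_mem_spanSpace g.2⟩

theorem ext_spanVec {Γ : Set (ℤ × ℤ)} {E : Type*} [NormedAddCommGroup E] [NormedSpace ℂ E]
    {A B : spanSpace Γ →L[ℂ] E} (h : ∀ g, A (spanVec g) = B (spanVec g)) : A = B := by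
  have hd : Dense (Submodule.span ℂ (Set.range (spanVec (Γ := Γ))) : Set (spanSpace Γ)) := by
    intro x
    rw [closure_subtype, ← Submodule.coe_subtype, ← Submodule.map_coe, Submodule.map_span,
      ← Set.range_comp]
    have hr : Set.range ((spanSpace Γ).subtype ∘ spanVec) = torusBasisVec '' Γ := by
      ext f
      simp [spanVec]
    rw [hr]
    exact x.2
  refine ContinuousLinearMap.ext_on hd ?_
  rintro _ ⟨g, rfl⟩
  exact h g

theorem add_coordStep_mem {Γ : Set (ℤ × ℤ)} (hinv : coordBiIsometry.IsInvariant (spanSpace Γ))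
    {g : ℤ × ℤ} (hg : g ∈ Γ) (k : Fin 2) : g + coordStep k ∈ Γ := by
  have h := hinv k _ (torusBasisVec_mem_spanSpace hg)
  rwa [show coordBiIsometry.op k = coordMul k from rfl, coordMul_torusBasisVec,
    torusBasisVec_mem_spanSpace_iff] at h

theorem add_nsmul_coordStep_mem {Γ : Set (ℤ × ℤ)}
    (hinv : coordBiIsometry.IsInvariant (spanSpace Γ)) {g : ℤ × ℤ} (hg : g ∈ Γ) (k : Fin 2)
    (n : ℕ) : g + n • coordStep k ∈ Γ := by
  induction n with
  | zero => simpa using hg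
  | succ n ih =>
    rw [succ_nsmul, ← add_assoc]
    exact add_coordStep_mem hinv ih k

/-! ### Matrix coefficients of intertwining maps -/

/-- `A` intertwines the coordinate multiplications on `H_Γ` and on `H_Γ'`. -/
def Intertwines {Γ Γ' : Set (ℤ × ℤ)} (hinv : coordBiIsometry.IsInvariant (spanSpace Γ))
    (A : spanSpace Γ → spanSpace Γ') : Prop :=
  ∀ k x, (A ((coordBiIsometry.restrict (spanSpace Γ) hinv).op k x) : L2Torus) = coordMul k (A x)

variable {Γ Γ' : Set (ℤ × ℤ)} {hinv : coordBiIsometry.IsInvariant (spanSpace Γ)}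

theorem restrict_op_spanVec (g : Γ) (k : Fin 2) :
    (coordBiIsometry.restrict (spanSpace Γ) hinv).op k (spanVec g) =
      spanVec ⟨g + coordStep k, add_coordStep_mem hinv g.2 k⟩ :=
  Subtype.ext (coordMul_torusBasisVec k g)

theorem Intertwines.inner_step {A : spanSpace Γ → spanSpace Γ'} (hA : Intertwines hinv A)
    (g : Γ) (k : Fin 2) (n : ℕ) (γ : ℤ × ℤ) :
    ⟪torusBasisVec (g + n • coordStep k + γ),
        (A (spanVec ⟨g + n • coordStep k, add_nsmul_coordStep_mem hinv g.2 k n⟩) : L2Torus)⟫_ℂ =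
      ⟪torusBasisVec (g + γ), (A (spanVec g) : L2Torus)⟫_ℂ := by
  induction n with
  | zero => simp
  | succ n ih =>
    rw [← ih, ← inner_torusBasisVec_coordMul k (g + n • coordStep k + γ), ← hA,
      restrict_op_spanVec]
    simp only [succ_nsmul, ← add_assoc]
    rw [add_right_comm _ (coordStep k) γ]

/-- The matrix coefficients of an intertwining map are constant along diagonals. -/
theorem Intertwines.inner_eq {A : spanSpace Γ → spanSpace Γ'} (hA : Intertwines hinv A)
    (g g' : Γ) (γ : ℤ × ℤ) :
    ⟪torusBasisVec (g + γ), (A (spanVec g) : L2Torus)⟫_ℂ =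
      ⟪torusBasisVec (g' + γ), (A (spanVec g') : L2Torus)⟫_ℂ := by
  have key : ∀ g : Γ, ∀ m n : ℕ, ∀ h : Γ, (h : ℤ × ℤ) = g + m • coordStep 0 + n • coordStep 1 →
      ⟪torusBasisVec (h + γ), (A (spanVec h) : L2Torus)⟫_ℂ =
        ⟪torusBasisVec (g + γ), (A (spanVec g) : L2Torus)⟫_ℂ := by
    rintro g m n ⟨h, hh⟩ rfl
    have h0 := hA.inner_step g 0 m γ
    rw [← h0]
    exact hA.inner_step ⟨g + m • coordStep 0, add_nsmul_coordStep_mem hinv g.2 0 m⟩ 1 n γ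
  obtain ⟨⟨a, b⟩, hg⟩ := g
  obtain ⟨⟨a', b'⟩, hg'⟩ := g'
  -- The componentwise maximum of the two exponents lies in `Γ` and is reached from both by
  -- nonnegative steps; truncation in `toNat` produces the maximum.
  have hm := add_nsmul_coordStep_mem hinv
    (add_nsmul_coordStep_mem hinv hg 0 (a' - a).toNat) 1 (b' - b).toNat
  rw [← key ⟨(a, b), hg⟩ _ _ ⟨_, hm⟩ rfl, ← key ⟨(a', b'), hg'⟩ (a - a').toNat (b - b').toNat
    ⟨_, hm⟩]
  simp only [coordStep, Matrix.cons_val_zero, Matrix.cons_val_one, Prod.smul_mk, smul_zero,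
    Prod.mk_add_mk, add_zero, Prod.mk.injEq, nsmul_eq_mul, mul_one, Int.ofNat_toNat]
  omega

/-- The whole diagonal is nonzero once one entry is, while vectors of `H_Γ'` have no coefficients
outside `Γ'`. -/
theorem Intertwines.add_mem {A : spanSpace Γ → spanSpace Γ'} (hA : Intertwines hinv A)
    {g : Γ} {γ : ℤ × ℤ} (h : ⟪torusBasisVec (g + γ), (A (spanVec g) : L2Torus)⟫_ℂ ≠ 0)
    (g' : Γ) : (g' + γ : ℤ × ℤ) ∈ Γ' := by
  by_contra hmem
  rw [hA.inner_eq g g'] at h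
  exact h (inner_eq_zero_of_mem_spanSpace hmem (A (spanVec g')).2)

/-- The adjoint `B` has the conjugate coefficient on the diagonal `-γ`, so `add_mem` applies in both
directions. It is used with `B` the inverse of a unitary, and with `A = B` a projection. -/
theorem Intertwines.eq_image {hinv' : coordBiIsometry.IsInvariant (spanSpace Γ')}
    {A : spanSpace Γ → spanSpace Γ'} {B : spanSpace Γ' → spanSpace Γ} (hA : Intertwines hinv A)
    (hB : Intertwines hinv' B) (hAB : ∀ x y, ⟪A x, y⟫_ℂ = ⟪x, B y⟫_ℂ) {g : Γ} {γ : ℤ × ℤ}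
    (h : ⟪torusBasisVec (g + γ), (A (spanVec g) : L2Torus)⟫_ℂ ≠ 0) :
    Γ' = (fun g => g + γ) '' Γ := by
  have hg' := hA.add_mem h g
  have h' : ⟪torusBasisVec ((g + γ) + -γ), (B (spanVec ⟨g + γ, hg'⟩) : L2Torus)⟫_ℂ ≠ 0 := by
    rw [add_neg_cancel_right]
    have hc := hAB (spanVec g) (spanVec ⟨g + γ, hg'⟩)
    simp only [Submodule.coe_inner, spanVec] at hc
    simp only [spanVec] at h ⊢
    rwa [← hc, ← inner_conj_symm, Ne, map_eq_zero]
  ext g'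
  constructor
  · intro hm
    exact ⟨g' + -γ, hB.add_mem (g := ⟨g + γ, hg'⟩) h' ⟨g', hm⟩, by simp⟩
  · rintro ⟨g₁, hg₁, rfl⟩
    exact hA.add_mem h ⟨g₁, hg₁⟩

theorem exists_eq_image_of_unitarilyEquivalent (hne : Γ.Nonempty)
    {hinv' : coordBiIsometry.IsInvariant (spanSpace Γ')}
    (h : (coordBiIsometry.restrict (spanSpace Γ) hinv).UnitarilyEquivalent
      (coordBiIsometry.restrict (spanSpace Γ') hinv')) :
    ∃ γ : ℤ × ℤ, Γ' = (fun g => g + γ) '' Γ := by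
  obtain ⟨U, hU⟩ := h
  obtain ⟨g, hg⟩ := hne
  have hA : Intertwines hinv U := fun k x => congrArg Subtype.val (hU k x)
  have hB : Intertwines hinv' U.symm := fun k y => by
    have := hU k (U.symm y)
    rw [U.apply_symm_apply] at this
    rw [← this, U.symm_apply_apply]
    rfl
  obtain ⟨h, hh⟩ : ∃ h, ⟪torusBasisVec h, (U (spanVec ⟨g, hg⟩) : L2Torus)⟫_ℂ ≠ 0 := by
    by_contra! hzero
    have h0 : (U (spanVec ⟨g, hg⟩) : L2Torus) = 0 :=
      ext_inner_torusBasisVec fun h => by rw [hzero, inner_zero_right]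
    rw [Submodule.coe_eq_zero, map_eq_zero_iff U U.injective] at h0
    exact orthonormal_torusBasisVec.ne_zero g (congrArg Subtype.val h0)
  refine ⟨h - g, hA.eq_image hB (fun x y => ?_) (g := ⟨g, hg⟩) (by simpa using hh)⟩
  rw [← U.inner_map_map x, U.apply_symm_apply]

theorem exists_eq_image_of_isReducible (hne : Γ.Nonempty)
    (h : (coordBiIsometry.restrict (spanSpace Γ) hinv).IsReducible) :
    ∃ γ : ℤ × ℤ, γ ≠ 0 ∧ Γ = (fun g => g + γ) '' Γ := by
  unfold CommutingIsometries.IsReducible CommutingIsometries.IsIrreducible at h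
  push Not at h
  obtain ⟨M, ⟨hM, hMV, hMV'⟩, hbot, htop⟩ := h
  have : CompleteSpace M := hM.completeSpace_coe
  have hP : Intertwines hinv M.starProjection := by
    intro k x
    have hx : (coordBiIsometry.restrict (spanSpace Γ) hinv).op k (M.starProjection x) =
        M.starProjection ((coordBiIsometry.restrict (spanSpace Γ) hinv).op k x) := by
      refine (Submodule.eq_starProjection_of_mem_of_inner_eq_zero
        (hMV k _ (M.starProjection_apply_mem x)) fun w hw => ?_).symm
      rw [← map_sub]
      exact Submodule.inner_left_of_mem_orthogonal hw
        (hMV' k _ (M.sub_starProjection_mem_orthogonal x))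
    exact congrArg Subtype.val hx.symm
  by_contra! hγ
  have hoff : ∀ (g : Γ) (γ : ℤ × ℤ), γ ≠ 0 →
      ⟪torusBasisVec (g + γ), (M.starProjection (spanVec g) : L2Torus)⟫_ℂ = 0 := by
    intro g γ h0
    by_contra hne0
    exact hγ γ h0 (hP.eq_image hP (M.inner_starProjection_left_eq_right) hne0)
  obtain ⟨g₀, hg₀⟩ := hne
  set c : ℂ := ⟪torusBasisVec ((⟨g₀, hg₀⟩ : Γ) + 0),
    (M.starProjection (spanVec ⟨g₀, hg₀⟩) : L2Torus)⟫_ℂ with hc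
  -- Only the main diagonal survives, and it is constant.
  have hscalar : M.starProjection = c • ContinuousLinearMap.id ℂ (spanSpace Γ) := by
    refine ext_spanVec fun g => Subtype.ext (ext_inner_torusBasisVec fun h => ?_)
    obtain ⟨γ, rfl⟩ : ∃ γ, h = g + γ := ⟨h - g, by simp⟩
    rcases eq_or_ne γ 0 with rfl | h0
    · rw [hP.inner_eq g ⟨g₀, hg₀⟩, ← hc]
      simp [spanVec, inner_smul_right, orthonormal_torusBasisVec.1 g]
    · rw [hoff g γ h0]
      simp [spanVec, inner_smul_right, orthonormal_torusBasisVec.2 (i := g + γ) (j := g) (by simpa)]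
  by_cases hc0 : c = 0
  · refine hbot (eq_bot_iff.2 fun x hx => ?_)
    rw [Submodule.mem_bot, ← Submodule.starProjection_eq_self_iff.2 hx, hscalar, hc0]
    simp
  · refine htop (eq_top_iff.2 fun x _ => ?_)
    have hmem : M.starProjection (c⁻¹ • x) ∈ M := M.starProjection_apply_mem _
    rw [hscalar] at hmem
    simpa [hc0] using hmem

/-! ### Shift operators -/

/-- The Hilbert basis of `L²(𝕋²)` formed by the monomials. -/
noncomputable def torusHilbertBasis : HilbertBasis (ℤ × ℤ) ℂ L2Torus :=
  HilbertBasis.mk orthonormal_torusBasisVec span_torusBasisVec_closure_eq_top.ge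

/-- The monomials, indexed with a shift of the exponent by `γ`. -/
noncomputable def torusHilbertBasisShift (γ : ℤ × ℤ) : HilbertBasis (ℤ × ℤ) ℂ L2Torus :=
  HilbertBasis.mk (v := torusBasisVec ∘ Equiv.addRight γ)
    (orthonormal_torusBasisVec.comp _ (Equiv.injective _))
    (by rw [EquivLike.range_comp, span_torusBasisVec_closure_eq_top])

/-- The unitary operator of multiplication by the monomial of exponent `γ`. -/
noncomputable def torusShift (γ : ℤ × ℤ) : L2Torus ≃ₗᵢ[ℂ] L2Torus :=
  torusHilbertBasis.repr.trans (torusHilbertBasisShift γ).repr.symm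

@[simp]
theorem torusShift_torusBasisVec (γ g : ℤ × ℤ) :
    torusShift γ (torusBasisVec g) = torusBasisVec (g + γ) := by
  have h1 : torusBasisVec g = torusHilbertBasis g := by
    rw [torusHilbertBasis, HilbertBasis.coe_mk]
  have h2 : torusBasisVec (g + γ) = torusHilbertBasisShift γ g := by
    rw [torusHilbertBasisShift, HilbertBasis.coe_mk]
    rfl
  rw [h1, h2, torusShift, LinearIsometryEquiv.trans_apply, HilbertBasis.repr_self,
    HilbertBasis.repr_symm_single]

theorem inner_torusShift_right (γ g : ℤ × ℤ) (f : L2Torus) :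
    ⟪torusBasisVec g, torusShift γ f⟫_ℂ = ⟪torusBasisVec (g + -γ), f⟫_ℂ := by
  rw [← (torusShift γ).inner_map_map (torusBasisVec (g + -γ)), torusShift_torusBasisVec,
    neg_add_cancel_right]

theorem inner_coordMul_right (k : Fin 2) (g : ℤ × ℤ) (f : L2Torus) :
    ⟪torusBasisVec g, coordMul k f⟫_ℂ = ⟪torusBasisVec (g + -coordStep k), f⟫_ℂ := by
  rw [← inner_torusBasisVec_coordMul k (g + -coordStep k), neg_add_cancel_right]

/-- Since `torusShift` is built from Hilbert bases rather than pointwise, Fourier coefficients are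
compared. -/
theorem torusShift_coordMul (γ : ℤ × ℤ) (k : Fin 2) (f : L2Torus) :
    torusShift γ (coordMul k f) = coordMul k (torusShift γ f) :=
  ext_inner_torusBasisVec fun g => by
    rw [inner_torusShift_right, inner_coordMul_right, inner_coordMul_right, inner_torusShift_right,
      add_right_comm]

theorem torusShift_neg_apply (γ : ℤ × ℤ) (f : L2Torus) :
    torusShift (-γ) f = (torusShift γ).symm f :=
  ext_inner_torusBasisVec fun g => by
    rw [inner_torusShift_right, neg_neg, ← torusShift_torusBasisVec,
      LinearIsometryEquiv.inner_map_eq_flip]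

theorem torusShift_mem_spanSpace {γ : ℤ × ℤ} (h : ∀ g ∈ Γ, g + γ ∈ Γ') {f : L2Torus}
    (hf : f ∈ spanSpace Γ) : torusShift γ f ∈ spanSpace Γ' := by
  have hle : spanSpace Γ ≤ (spanSpace Γ').comap (torusShift γ).toLinearEquiv.toLinearMap :=
    spanSpace_le ((isClosed_spanSpace Γ').preimage (torusShift γ).continuous) fun g hg => by
      simpa using torusBasisVec_mem_spanSpace (h g hg)
  exact hle hf

theorem map_torusShift_spanSpace (Γ : Set (ℤ × ℤ)) (γ : ℤ × ℤ) :
    (spanSpace Γ).map (torusShift γ).toLinearEquiv.toLinearMap =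
      spanSpace ((fun g => g + γ) '' Γ) := by
  apply le_antisymm
  · rintro _ ⟨f, hf, rfl⟩
    exact torusShift_mem_spanSpace (fun g hg => Set.mem_image_of_mem (fun g => g + γ) hg) hf
  · intro f hf
    have hsub : ∀ g ∈ (fun g => g + γ) '' Γ, g + -γ ∈ Γ := by
      rintro _ ⟨g, hg, rfl⟩
      simpa using hg
    refine Submodule.mem_map.2 ⟨torusShift (-γ) f, torusShift_mem_spanSpace hsub hf, ?_⟩
    rw [torusShift_neg_apply]
    exact (torusShift γ).apply_symm_apply f

theorem unitarilyEquivalent_of_eq_image {hinv' : coordBiIsometry.IsInvariant (spanSpace Γ')}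
    {γ : ℤ × ℤ} (h : Γ' = (fun g => g + γ) '' Γ) :
    (coordBiIsometry.restrict (spanSpace Γ) hinv).UnitarilyEquivalent
      (coordBiIsometry.restrict (spanSpace Γ') hinv') := by
  subst h
  refine ⟨((torusShift γ).submoduleMap (spanSpace Γ)).trans
    (LinearIsometryEquiv.ofEq _ _ (map_torusShift_spanSpace Γ γ)), fun k x => Subtype.ext ?_⟩
  exact torusShift_coordMul γ k x

/-! ### Reducibility from a self-adjoint operator commuting with the isometries -/

/-- Writing `S = B* B`, the quadratic form at `x` is `‖B x‖²`. -/
theorem ContinuousLinearMap.apply_eq_zero_of_nonneg_of_inner_eq_zero {H : Type*}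
    [NormedAddCommGroup H] [InnerProductSpace ℂ H] [CompleteSpace H] {S : H →L[ℂ] H} (hS : 0 ≤ S)
    {x : H} (hx : ⟪S x, x⟫_ℂ = 0) : S x = 0 := by
  obtain ⟨B, rfl⟩ := CStarAlgebra.nonneg_iff_eq_star_mul_self.1 hS
  rw [mul_apply_eq_comp, ContinuousLinearMap.star_eq_adjoint,
    ContinuousLinearMap.adjoint_inner_left, inner_self_eq_zero] at hx
  rw [mul_apply_eq_comp, hx, map_zero]

/-- A family of isometries that commutes with a self-adjoint operator which has a null
vector outside its kernel is reducible. -/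
theorem CommutingIsometries.isReducible_of_inner_eq_zero {ι H : Type*} [NormedAddCommGroup H]
    [InnerProductSpace ℂ H] [CompleteSpace H] (V : CommutingIsometries ι H) {S : H →L[ℂ] H}
    (hS : IsSelfAdjoint S) (hcomm : ∀ i x, S (V.op i x) = V.op i (S x)) {x₀ : H} (hx₀ : ⟪S x₀, x₀⟫_ℂ = 0)
    (hSx₀ : S x₀ ≠ 0) : V.IsReducible := by
  have hpos : ¬ 0 ≤ S := fun h => hSx₀ (ContinuousLinearMap.apply_eq_zero_of_nonneg_of_inner_eq_zero h hx₀)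
  have hneg : ¬ S ≤ 0 := fun h => hSx₀ <| by
    simpa using ContinuousLinearMap.apply_eq_zero_of_nonneg_of_inner_eq_zero (x := x₀)
      (neg_nonneg.2 h) (by simpa using hx₀)
  have hP : ∀ i x, S⁺ (V.op i x) = V.op i (S⁺ x) := fun i x => by
    have h : Commute S (V.op i).toContinuousLinearMap := ContinuousLinearMap.ext (hcomm i)
    exact DFunLike.congr_fun (h.cfcₙ_real (·⁺)).eq x
  have hPsa : IsSelfAdjoint S⁺ := .of_nonneg (CFC.posPart_nonneg S)
  have hred : V.IsReducing S⁺.ker := by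
    refine ⟨S⁺.isClosed_ker, fun i x hx => ?_, fun i x hx => ?_⟩
    · have hx' : S⁺ x = 0 := LinearMap.mem_ker.1 hx
      refine LinearMap.mem_ker.2 ?_
      change S⁺ (V.op i x) = 0
      rw [hP, hx', map_zero]
    -- Describing the complement as a closed range avoids adjoints of the isometries, which need not
    -- leave the kernel invariant a priori.
    · have hk : S⁺.kerᗮ = S⁺.range.topologicalClosure := by
        rw [ContinuousLinearMap.orthogonal_ker, ← ContinuousLinearMap.star_eq_adjoint, hPsa.star_eq]
      rw [hk] at hx ⊢
      refine map_mem_closure (V.op i).continuous hx ?_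
      rintro _ ⟨y, rfl⟩
      exact ⟨V.op i y, hP i y⟩
  intro hirr
  rcases hirr _ hred with h | h
  -- `S⁺ S⁻ = 0` puts the range of `S⁻` in the kernel of `S⁺`.
  · have hz : S⁻ = 0 := ContinuousLinearMap.ext fun x => by
      have hx : S⁻ x ∈ S⁺.ker :=
        LinearMap.mem_ker.2 (DFunLike.congr_fun (CFC.posPart_mul_negPart S) x)
      rw [h] at hx
      simpa using hx
    exact hpos ((CFC.negPart_eq_zero_iff S hS).1 hz)
  · have hz : S⁺ = 0 := ContinuousLinearMap.ext fun x => by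
      have hx : x ∈ S⁺.ker := h ▸ Submodule.mem_top
      simpa using hx
    exact hneg ((CFC.posPart_eq_zero_iff S hS).1 hz)

/-- The operator of multiplication by a monomial whose exponent preserves `Γ`, on `H_Γ`. -/
noncomputable def spanShift (γ : ℤ × ℤ) (h : ∀ g ∈ Γ, g + γ ∈ Γ) : spanSpace Γ →L[ℂ] spanSpace Γ :=
  (torusShift γ).toContinuousLinearEquiv.toContinuousLinearMap.restrict
    (fun _ hf => torusShift_mem_spanSpace h hf)

theorem coe_spanShift {γ : ℤ × ℤ} (h : ∀ g ∈ Γ, g + γ ∈ Γ) (x : spanSpace Γ) :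
    (spanShift γ h x : L2Torus) = torusShift γ x := rfl

theorem adjoint_spanShift {γ : ℤ × ℤ} (h : ∀ g ∈ Γ, g + γ ∈ Γ) (h' : ∀ g ∈ Γ, g + -γ ∈ Γ) :
    ContinuousLinearMap.adjoint (spanShift γ h) = spanShift (-γ) h' := by
  symm
  rw [ContinuousLinearMap.eq_adjoint_iff]
  intro x y
  rw [Submodule.coe_inner, Submodule.coe_inner, coe_spanShift, coe_spanShift, torusShift_neg_apply,
    LinearIsometryEquiv.inner_map_eq_flip, LinearIsometryEquiv.symm_symm]

theorem isReducible_of_eq_image (hne : Γ.Nonempty) {γ : ℤ × ℤ} (hγ : γ ≠ 0)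
    (h : Γ = (fun g => g + γ) '' Γ) :
    (coordBiIsometry.restrict (spanSpace Γ) hinv).IsReducible := by
  have hadd : ∀ g ∈ Γ, g + γ ∈ Γ := fun g hg => by
    rw [h]; exact ⟨g, hg, rfl⟩
  have hsub : ∀ g ∈ Γ, g + -γ ∈ Γ := fun g hg => by
    rw [h] at hg
    obtain ⟨g', hg', rfl⟩ := hg
    simpa using hg'
  obtain ⟨g, hg⟩ := hne
  set S : spanSpace Γ →L[ℂ] spanSpace Γ := spanShift γ hadd + spanShift (-γ) hsub with hSdef
  have hS : IsSelfAdjoint S := by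
    rw [ContinuousLinearMap.isSelfAdjoint_iff', hSdef, ← adjoint_spanShift hadd hsub, map_add,
      ContinuousLinearMap.adjoint_adjoint, add_comm]
  have hSg : (S (spanVec ⟨g, hg⟩) : L2Torus) = torusBasisVec (g + γ) + torusBasisVec (g + -γ) := by
    simp [hSdef, coe_spanShift, spanVec]
  have hdiag : ⟪S (spanVec ⟨g, hg⟩), spanVec ⟨g, hg⟩⟫_ℂ = 0 := by
    rw [Submodule.coe_inner, hSg, inner_add_left]
    simp [spanVec, orthonormal_torusBasisVec.2 (i := g + γ) (j := g) (by simpa),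
      orthonormal_torusBasisVec.2 (i := g + -γ) (j := g) (by simpa)]
  have hne0 : S (spanVec ⟨g, hg⟩) ≠ 0 := by
    intro h0
    have h1 : ⟪torusBasisVec (g + γ), (S (spanVec ⟨g, hg⟩) : L2Torus)⟫_ℂ = 1 := by
      -- `ℤ × ℤ` has no 2-torsion, so the two shifted monomials cannot coincide.
      have hne : g + γ ≠ g + -γ := fun he => hγ (self_eq_neg.1 (add_left_cancel he))
      rw [hSg, inner_add_right, orthonormal_torusBasisVec.2 hne]
      simp [orthonormal_torusBasisVec.1]
    simp [h0] at h1
  refine CommutingIsometries.isReducible_of_inner_eq_zero _ hS (fun k x => Subtype.ext ?_) hdiag hne0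
  change torusShift γ (coordMul k x) + torusShift (-γ) (coordMul k x) =
    coordMul k (torusShift γ x + torusShift (-γ) x)
  rw [torusShift_coordMul, torusShift_coordMul, map_add]

theorem corollary8p5 (Γ Γ' : Set (ℤ × ℤ))
    (hne : Γ.Nonempty) (hproper : Γ ≠ Set.univ)
    (hne' : Γ'.Nonempty) (hproper' : Γ' ≠ Set.univ)
    (hinv : coordBiIsometry.IsInvariant (spanSpace Γ))
    (hinv' : coordBiIsometry.IsInvariant (spanSpace Γ')) :
    ((coordBiIsometry.restrict (spanSpace Γ) hinv).UnitarilyEquivalent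
        (coordBiIsometry.restrict (spanSpace Γ') hinv') ↔
      ∃ γ : ℤ × ℤ, Γ' = (fun g => g + γ) '' Γ) ∧
    ((coordBiIsometry.restrict (spanSpace Γ) hinv).IsReducible ↔
      ∃ γ : ℤ × ℤ, γ ≠ 0 ∧ Γ = (fun g => g + γ) '' Γ) := by
  refine ⟨⟨exists_eq_image_of_unitarilyEquivalent hne, ?_⟩,
    exists_eq_image_of_isReducible hne, ?_⟩
  · rintro ⟨γ, h⟩
    exact unitarilyEquivalent_of_eq_image h
  · rintro ⟨γ, hγ, h⟩
    exact isReducible_of_eq_image hne hγ h
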